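/- Let $K$ be an oriented knot, given by a planar diagram with $m\ge 1$ crossings and arcs $x_1,\dots,x_m$ numbered cyclically along $K$, so that arc $x_i$ passes into arc $x_{i+1}$ below an arc $x_{j(i)}$ at the $i$-th crossing. Let $\Gamma_K$ be its knot group, in the Wirtinger presentation: it is generated by the meridians $x_1,\dots,x_m$, with one relation for each crossing, namely $x_i x_{j(i)} = x_{j(i)} x_{i+1}$ if $x_i$ lies on the left of the oriented arc $x_{j(i)}$, and $x_{i+1}x_{j(i)} = x_{j(i)}x_i$ if it lies on the right. Let $\Delta(t)\in\mathbb{Z}[t,t^{-1}]$ be the Alexander polynomial of $K$, that is, the greatest common divisor, unique up to units $\pm t^r$, of the $(m-1)\times(m-1)$ minors of the Alexander matrix $A(t)$, the $m \times m$ Jacobian matrix of the Fox derivatives of the Wirtinger relators with every meridian sent to $t$. Let $p$ be a prime and $\alpha$ a non-zero element of a finite extension of $\mathbb{F}_p$. Put $d=[\mathbb{F}_p(\alpha):\mathbb{F}_p]$, so that $\mathbb{F}_p(\alpha)=\mathbb{F}_{p^d}$, let $n$ be the multiplicative order of $\alpha$, and let $$G_\alpha=\langle\alpha\rangle\ltimes\mathbb{F}_{p^d}=\{z\mapsto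 \alpha^k z+b : k\in\mathbb{Z},\ b\in\mathbb{F}_{p^d}\}\le \mathrm{Aff}(\mathbb{F}_{p^d}).$$ **Theorem 2.** There is a homomorphism $\rho_\alpha:\Gamma_K\to\mathrm{Aff}(\mathbb{F}_{p^d})$ which sends every meridian $x_i$ to a map of the form $z\mapsto\alpha z+y_i$ and whose image is non-abelian and equal to $G_\alpha$, if and only if $\alpha$ is a root of $\Delta(t) \bmod p$. Moreover, for every homomorphism $\rho_\alpha:\Gamma_K\to\mathrm{Aff}(\mathbb{F}_{p^d})$ which sends every $x_i$ to a map of the form $z\mapsto\alpha z+y_i$ and has non-abelian image, the image is equal to $G_\alpha$, is metabelian, and has order $np^d$. -/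

import Mathlib

open scoped LaurentPolynomial

noncomputable section

/-- An oriented planar diagram, with `n ≥ 1` crossings, of a knot (one component).

Travelling once along the knot one meets `2 * n` crossing passes, at positions `k : ZMod (2 * n)`;
each crossing is met once on its upper and once on its lower strand.  The `n` arcs (maximal pieces
between two consecutive underpasses) are numbered cyclically along the knot, and the crossings are
numbered so that arc `i` ends, and arc `i + 1` begins, at the underpass of crossing `i`.
Planarity of such a code is the field `planar` of `KnotDiagram` below. -/
structure KnotCode (n : ℕ) where
  /-- The crossing met at position `k`, and whether it is met on the upper strand (`true`) or on the
  lower strand (`false`). -/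
  pass : ZMod (2 * n) ≃ ZMod n × Bool
  /-- The arc that arrives at position `k`. -/
  arc : ZMod (2 * n) → ZMod n
  /-- At an overpass the same arc goes on. -/
  arc_over : ∀ i, arc (pass.symm (i, true) + 1) = arc (pass.symm (i, true))
  /-- Arc `i` arrives at the underpass of crossing `i`. -/
  arc_under : ∀ i, arc (pass.symm (i, false)) = i
  /-- Arc `i + 1` leaves the underpass of crossing `i`. -/
  arc_under_succ : ∀ i, arc (pass.symm (i, false) + 1) = i + 1
  /-- `true` if, at crossing `i`, the lower strand passes from the left to the right of the
  (oriented) upper strand, and `false` if it passes from the right to the left.  In the first case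
  the arc `i` lies on the left and the arc `i + 1` on the right of the upper strand. -/
  leftToRight : ZMod n → Bool

namespace KnotCode

variable {n : ℕ} (D : KnotCode n)

/-- The arc `j(i)` that forms the upper strand at crossing `i`. -/
def overArc (i : ZMod n) : ZMod n := D.arc (D.pass.symm (i, true))

/-- The position at which a directed edge arrives.  The edge `k` of the diagram leads from
position `k - 1` to position `k`; the directed edge `(k, true)` is this edge run through along the
orientation of the knot, and `(k, false)` is the same edge run through backwards. -/
def target : ZMod (2 * n) × Bool → ZMod (2 * n)
  | (k, true) => k
  | (k, false) => k - 1

/-- The directed edge that leaves position `k` along (`true`) or against (`false`) the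
orientation of the knot. -/
def leave (k : ZMod (2 * n)) : Bool → ZMod (2 * n) × Bool
  | true => (k + 1, true)
  | false => (k, false)

/-- Follow the directed edge `e` up to the crossing at which it arrives, and turn left there, into
the other strand of that crossing.  The new edge is run through along the orientation of the knot
or against it, according to: whether `e` is, whether `e` arrives on the upper strand, and in which
direction the lower strand crosses the upper one.  For instance, arriving forward on the upper
strand when the lower strand passes from left to right, the left turn leads backward along the
lower strand. -/
def turnLeft (e : ZMod (2 * n) × Bool) : ZMod (2 * n) × Bool :=
  let c := D.pass (target e)
  leave (D.pass.symm (c.1, !c.2)) (xor (xor e.2 c.2) (!D.leftToRight c.1))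

/-- The faces (regions) of the diagram: the orbits of directed edges under `turnLeft`; the orbit of
`e` consists of the boundary edges of the region on the left of `e`. -/
def Face : Type := Quot fun e e' : ZMod (2 * n) × Bool => e' = D.turnLeft e

end KnotCode

/-- A knot diagram on the sphere: the 4-valent surface map with `n` vertices and `2 * n` edges that
the code describes (it is connected, since there is one component) has Euler characteristic
`n - 2 * n + #faces = 2`, so that the surface is the sphere. -/
structure KnotDiagram (n : ℕ) extends KnotCode n where
  planar : Nat.card toKnotCode.Face = n + 2

/-- The action of the free group on `ι` on `ℤ[t, t⁻¹]^ι` in which the generator `x_i` acts by the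
affine map `v ↦ t v + e_i`. -/
def foxAction (ι : Type) [DecidableEq ι] :
    FreeGroup ι →* ((ι → ℤ[T;T⁻¹]) ≃ᵃ[ℤ[T;T⁻¹]] (ι → ℤ[T;T⁻¹])) :=
  FreeGroup.lift fun i =>
    AffineEquiv.constVAdd ℤ[T;T⁻¹] (ι → ℤ[T;T⁻¹]) (Pi.single i 1) *
      (LinearEquiv.smulOfUnit (LaurentPolynomial.isUnit_T (R := ℤ) 1).unit).toAffineEquiv

/-- The row vector `(∂w/∂x_j)_j` of the Fox derivatives of a word `w` in the free group on `ι`, with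
the group ring mapped to `ℤ[t, t⁻¹]` by sending every generator to `t`.  It is characterized by
`∂x_i/∂x_j = δ_ij` and `∂(uv)/∂x_j = ∂u/∂x_j + u ∂v/∂x_j`, where the `u` in front of `∂v/∂x_j`
stands for its image, a power of `t`; hence it is the image of `0` under the action of `w` by
`foxAction`. -/
def foxDerivative {ι : Type} [DecidableEq ι] (w : FreeGroup ι) : ι → ℤ[T;T⁻¹] :=
  foxAction ι w 0

namespace KnotDiagram

variable {n : ℕ} (D : KnotDiagram n)

/-- The Wirtinger relator of crossing `i`, that is, the relation `x_i x_j = x_j x_(i+1)` or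
`x_(i+1) x_j = x_j x_i` with `j = j(i)` the arc of the upper strand. -/
def relator (i : ZMod n) : FreeGroup (ZMod n) :=
  let x : ZMod n → FreeGroup (ZMod n) := FreeGroup.of
  let j := D.overArc i
  if D.leftToRight i then x i * x j * (x (i + 1))⁻¹ * (x j)⁻¹
  else x (i + 1) * x j * (x i)⁻¹ * (x j)⁻¹

/-- The knot group `Γ_K`, in the Wirtinger presentation. -/
abbrev knotGroup : Type := PresentedGroup (Set.range D.relator)

/-- The meridian of arc `i`, the `i`-th Wirtinger generator. -/
def meridian (i : ZMod n) : D.knotGroup := PresentedGroup.of i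

/-- The Alexander matrix `A(t)`: the Jacobian of Fox derivatives of the Wirtinger relators, over
`ℤ[t, t⁻¹]` (the abelianization of the knot group sends every meridian to `t`). -/
def alexanderMatrix : Matrix (ZMod n) (ZMod n) ℤ[T;T⁻¹] :=
  Matrix.of fun i => foxDerivative (D.relator i)

/-- `Δ` is an Alexander polynomial of the knot: a greatest common divisor in `ℤ[t, t⁻¹]` of the
`(n - 1) × (n - 1)` minors of the Alexander matrix, which are, up to sign, the entries of its
adjugate.  It is unique up to units `± t ^ m`. -/
def IsAlexanderPolynomial [NeZero n] (Δ : ℤ[T;T⁻¹]) : Prop :=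
  (∀ i j, Δ ∣ D.alexanderMatrix.adjugate i j) ∧
    ∀ δ : ℤ[T;T⁻¹], (∀ i j, δ ∣ D.alexanderMatrix.adjugate i j) → δ ∣ Δ

/-- Every knot diagram has an Alexander polynomial. -/
theorem exists_isAlexanderPolynomial [NeZero n] : ∃ Δ, D.IsAlexanderPolynomial Δ := by
  classical
  have : UniqueFactorizationMonoid ℤ[T;T⁻¹] :=
    UniqueFactorizationMonoid.of_isLocalization
      (Submonoid.powers (Polynomial.X : Polynomial ℤ)) ℤ[T;T⁻¹]
  let _ := UniqueFactorizationMonoid.strongNormalizationMonoid (α := ℤ[T;T⁻¹])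
  let _ := UniqueFactorizationMonoid.toNormalizedGCDMonoid ℤ[T;T⁻¹]
  refine ⟨(Finset.univ : Finset (ZMod n × ZMod n)).gcd
    fun q => D.alexanderMatrix.adjugate q.1 q.2, ?_, ?_⟩
  · intro i j
    exact Finset.gcd_dvd (f := fun q : ZMod n × ZMod n => D.alexanderMatrix.adjugate q.1 q.2)
      (Finset.mem_univ (i, j))
  · intro δ h
    exact Finset.dvd_gcd fun q _ => h q.1 q.2

end KnotDiagram

/-- `Δ (mod p)` vanishes at the non-zero element `α` of an extension `k` of `𝔽_p`. -/
def IsRootMod (p : ℕ) {k : Type*} [Field k] [Algebra (ZMod p) k] (Δ : ℤ[T;T⁻¹]) (α : kˣ) : Prop :=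
  LaurentPolynomial.eval₂ ((algebraMap (ZMod p) k).comp (Int.castRingHom (ZMod p))) α Δ = 0

/-- The subgroup `G_α = ⟨α⟩ ⋉ k` of `Aff(k)`: the maps `z ↦ α ^ m z + b`, for `m : ℤ` and
`b : k`. -/
def affineSemidirect {k : Type*} [Field k] (α : kˣ) : Subgroup (k ≃ᵃ[k] k) where
  carrier := {g | ∃ (m : ℤ) (b : k), ∀ z, g z = ((α ^ m : kˣ) : k) * z + b}
  one_mem' := ⟨0, 0, fun z => by simp⟩
  mul_mem' := by
    rintro g h ⟨m, b, hg⟩ ⟨m', b', hh⟩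
    refine ⟨m + m', ((α ^ m : kˣ) : k) * b' + b, fun z => ?_⟩
    rw [AffineEquiv.mul_def, AffineEquiv.trans_apply, hg, hh, zpow_add, Units.val_mul]
    ring
  inv_mem' := by
    rintro g ⟨m, b, hg⟩
    refine ⟨-m, -(((α ^ (-m) : kˣ) : k) * b), fun z => ?_⟩
    apply g.injective
    have h1 : g (g⁻¹ z) = z := g.apply_symm_apply z
    have h2 : ((α ^ m : kˣ) : k) * ((α ^ (-m) : kˣ) : k) = 1 := by
      rw [← Units.val_mul, ← zpow_add]; simp
    rw [h1, hg]
    linear_combination (b - z) * h2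

/-- The homomorphism `ρ` sends every meridian of the diagram to an affine map of the form
`z ↦ α z + y`. -/
def KnotDiagram.HasSlope {n : ℕ} (D : KnotDiagram n) {k : Type*} [Field k]
    (ρ : D.knotGroup →* (k ≃ᵃ[k] k)) (α : kˣ) : Prop :=
  ∀ i, ∃ y : k, ∀ z, ρ (D.meridian i) z = (α : k) * z + y

/-- The group `G` is not abelian. -/
def IsNonabelian (G : Type*) [Group G] : Prop := ∃ a b : G, a * b ≠ b * a

/-- The group `G` is metabelian: its second derived subgroup `G''` is trivial. -/
def IsMetabelian (G : Type*) [Group G] : Prop := derivedSeries G 2 = ⊥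

end

/-!
Maps `z ↦ α z + y_i` assigned to the meridians satisfy the Wirtinger relations exactly if `y` is in
the kernel of the Alexander matrix `A(t)` at `t = α`
(`KnotDiagram.exists_hasSlope_isNonabelian_iff`).  Constant vectors always are, and they give
abelian images; a non-constant `y` gives a non-abelian image, because it cannot exist for `α = 1`.
So there is a non-abelian representation if and only if the kernel of `A(α)` is more than a line,
that is, if all `(n - 1) × (n - 1)` minors of `A(t)` vanish at `α`.

It remains to see that this means `Δ(α) = 0`.  Vanishing of the minors does not in general imply
vanishing of their greatest common divisor modulo `p`; here it does because the minors are
associated to each other (`KnotDiagram.IsAlexanderPolynomial.associated_adjugate`).  This follows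
from `A(t) 1 = 0` and from a linear relation between the rows with coefficients `± t ^ r`, and
the latter is where planarity enters.  It is built from the Alexander numbering of the regions, in
which the number on the left of an edge exceeds the number on its right by one.  Such a numbering
exists since the sphere has no first cohomology, which for the combinatorial diagrams used here is
a dimension count based on Euler's formula (`KnotCode.range_coboundary_eq`).

For the image: a non-abelian subgroup of `⟨α⟩ ⋉ k` contains a non-zero translation, and if it also
contains a map of slope `α`, its translations form a subspace of `k` over `𝔽_p(α) = k`, hence
all of `k` (`eq_affineSemidirect_of_not_comm`).
-/

open Matrix

/-! ### Corank one: the adjugate of a matrix with known left and right kernel vectors -/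

section Adjugate

variable {ι R : Type*} [Fintype ι] [DecidableEq ι] [CommRing R] [IsDomain R]

/-- If the rows of `A` sum to zero, then `A.adjugate i j` does not depend on `i`. -/
theorem adjugate_eq_of_mulVec_one {A : Matrix ι ι R} (hA : A *ᵥ 1 = 0) (i i' j : ι) :
    A.adjugate i j = A.adjugate i' j := by
  have hdet : (A.updateRow j (Pi.single i 1 + (-1 : R) • Pi.single i' 1)).det = 0 := by
    refine exists_mulVec_eq_zero_iff.1 ⟨1, fun h => one_ne_zero (congrFun h i), ?_⟩
    rw [updateRow_mulVec, hA]
    ext a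
    by_cases h : a = j
    · subst h; simp [add_dotProduct]
    · simp [h]
  rw [det_updateRow_add, det_updateRow_smul, ← adjugate_apply, ← adjugate_apply] at hdet
  linear_combination hdet

/-- A left kernel vector `u` makes the rows of the adjugate proportional to `u`. -/
theorem mul_adjugate_eq_of_vecMul {A : Matrix ι ι R} {u : ι → R} (hu : u ≠ 0)
    (hA : u ᵥ* A = 0) (i j j' : ι) :
    u j' * A.adjugate i j = u j * A.adjugate i j' := by
  have key : ∀ a b, A.adjugate a b = (A.updateCol a (Pi.single b 1)).det := fun a b => by
    rw [← transpose_apply A.adjugate, adjugate_transpose, adjugate_apply, ← det_transpose,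
      updateRow_transpose, transpose_transpose]
  have hdet : (A.updateCol i (u j' • Pi.single j 1 + (-u j) • Pi.single j' 1)).det = 0 := by
    refine exists_vecMul_eq_zero_iff.1 ⟨u, hu, ?_⟩
    rw [vecMul_updateCol, hA]
    ext a
    by_cases h : a = i
    · subst h; simp [dotProduct_add, mul_comm]
    · simp [h]
  rw [det_updateCol_add, det_updateCol_smul, det_updateCol_smul, ← key, ← key] at hdet
  linear_combination hdet

/-- If `A` has the right kernel vector `1` and a left kernel vector with unit entries, then all
entries of its adjugate are associated: the ideal that they generate is principal. -/
theorem adjugate_dvd_adjugate {A : Matrix ι ι R} (hA : A *ᵥ 1 = 0) {u : ι → R}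
    (hu : ∀ i, IsUnit (u i)) (huA : u ᵥ* A = 0) (i j i' j' : ι) :
    A.adjugate i j ∣ A.adjugate i' j' := by
  have hu0 : u ≠ 0 := fun h => (hu i).ne_zero (congrFun h i)
  rw [adjugate_eq_of_mulVec_one hA i' i j', ← (hu j).dvd_mul_left,
    ← mul_adjugate_eq_of_vecMul hu0 huA]
  exact dvd_mul_left _ _

/-- The kernel of a matrix with zero row sums contains the constant vectors; given a left kernel
vector without zero entries, it contains nothing else unless the adjugate vanishes. -/
theorem exists_mulVec_eq_zero_not_const_iff {A : Matrix ι ι R} (hA : A *ᵥ 1 = 0) {u : ι → R}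
    (hu : ∀ i, u i ≠ 0) (huA : u ᵥ* A = 0) (i j : ι) :
    (∃ v, A *ᵥ v = 0 ∧ ∃ a b, v a ≠ v b) ↔ A.adjugate i j = 0 := by
  rw [adjugate_apply, ← exists_mulVec_eq_zero_iff]
  constructor
  · rintro ⟨v, hv, a, b, hab⟩
    refine ⟨v - v i • 1, fun h => hab ?_, ?_⟩
    · have ha := congrFun h a
      have hb := congrFun h b
      simp only [Pi.sub_apply, Pi.smul_apply, Pi.one_apply, smul_eq_mul, mul_one,
        Pi.zero_apply] at ha hb
      linear_combination ha - hb
    · rw [updateRow_mulVec, mulVec_sub, mulVec_smul, hA, hv]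
      ext c
      by_cases h : c = j
      · subst h; simp
      · simp [h]
  · rintro ⟨v, hv0, hv⟩
    rw [updateRow_mulVec] at hv
    have hi : v i = 0 := by simpa using congrFun hv j
    have hne : ∀ a, a ≠ j → (A *ᵥ v) a = 0 := fun a ha => by simpa [ha] using congrFun hv a
    refine ⟨v, funext fun a => ?_, ?_⟩
    · by_cases ha : a = j
      · -- the `j`-th row is a combination of the other rows
        have h0 : u ⬝ᵥ (A *ᵥ v) = 0 := by rw [dotProduct_mulVec, huA, zero_dotProduct]
        rw [dotProduct, Finset.sum_eq_single j (fun b _ hb => by rw [hne b hb, mul_zero])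
          (fun h => absurd (Finset.mem_univ j) h)] at h0
        rw [ha]
        exact (mul_eq_zero.1 h0).resolve_left (hu j)
      · exact hne a ha
    · obtain ⟨b, hb⟩ := Function.ne_iff.1 hv0
      exact ⟨b, i, by rwa [hi]⟩

end Adjugate

/-! ### The Alexander numbering of the regions of a planar diagram -/

theorem ZMod.eq_zero_apply_of_add_one {N : ℕ} [NeZero N] {β : Type*} {g : ZMod N → β}
    (h : ∀ k, g (k + 1) = g k) (k : ZMod N) : g k = g 0 := by
  have : ∀ m : ℕ, g (m : ZMod N) = g 0 := fun m => by
    induction m with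
    | zero => simp
    | succ m ih => rw [Nat.cast_succ, h, ih]
  simpa using this k.val

namespace KnotCode

variable {n : ℕ} (D : KnotCode n)

/-- The position of the overpass of crossing `i`. -/
def overPos (i : ZMod n) : ZMod (2 * n) := D.pass.symm (i, true)

/-- The position of the underpass of crossing `i`. -/
def underPos (i : ZMod n) : ZMod (2 * n) := D.pass.symm (i, false)

@[simp] theorem pass_overPos (i : ZMod n) : D.pass (D.overPos i) = (i, true) := by simp [overPos]

@[simp] theorem pass_underPos (i : ZMod n) : D.pass (D.underPos i) = (i, false) := by
  simp [underPos]

theorem exists_eq_pos (k : ZMod (2 * n)) : ∃ i, k = D.overPos i ∨ k = D.underPos i := by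
  obtain ⟨⟨i, b⟩, rfl⟩ := D.pass.symm.surjective k
  cases b
  · exact ⟨i, Or.inr rfl⟩
  · exact ⟨i, Or.inl rfl⟩

theorem sum_positions [NeZero n] {M : Type*} [AddCommMonoid M] (F : ZMod (2 * n) → M) :
    ∑ k, F k = ∑ i, (F (D.overPos i) + F (D.underPos i)) := by
  rw [← Equiv.sum_comp D.pass.symm, Fintype.sum_prod_type]
  simp [overPos, underPos]

/-- At each of the four corners of a crossing, a function on the directed edges that is invariant
under `turnLeft` takes the same value on the two directed edges that border this corner. -/
theorem corners {β : Type*} {f : ZMod (2 * n) × Bool → β} (hf : ∀ e, f (D.turnLeft e) = f e)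
    (i : ZMod n) :
    if D.leftToRight i then
      f (D.overPos i, true) = f (D.underPos i, false) ∧
      f (D.underPos i, true) = f (D.overPos i + 1, true) ∧
      f (D.overPos i + 1, false) = f (D.underPos i + 1, true) ∧
      f (D.underPos i + 1, false) = f (D.overPos i, false)
    else
      f (D.overPos i, true) = f (D.underPos i + 1, true) ∧
      f (D.underPos i + 1, false) = f (D.overPos i + 1, true) ∧
      f (D.overPos i + 1, false) = f (D.underPos i, false) ∧
      f (D.underPos i, true) = f (D.overPos i, false) := by
  have h1 := hf (D.overPos i, true)
  have h2 := hf (D.underPos i, true)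
  have h3 := hf (D.overPos i + 1, false)
  have h4 := hf (D.underPos i + 1, false)
  have hs1 : D.pass.symm (i, true) = D.overPos i := rfl
  have hs2 : D.pass.symm (i, false) = D.underPos i := rfl
  cases h : D.leftToRight i <;>
    simp_all [turnLeft, target, leave]

/-- A function on the directed edges that is invariant under turning left and under reversal is
constant: the regions are connected to each other across edges. -/
theorem eq_of_turnLeft_of_reverse [NeZero n] {β : Type*} {f : ZMod (2 * n) × Bool → β}
    (hf : ∀ e, f (D.turnLeft e) = f e) (hr : ∀ k, f (k, true) = f (k, false))
    (e : ZMod (2 * n) × Bool) : f e = f (0, true) := by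
  have h : ∀ k, f (k, true) = f (0, true) :=
    ZMod.eq_zero_apply_of_add_one (g := fun k => f (k, true)) fun k => by
      obtain ⟨i, rfl | rfl⟩ := D.exists_eq_pos k <;>
        · have := D.corners hf i
          grind
  obtain ⟨k, b⟩ := e
  cases b
  · rw [← hr, h]
  · exact h k

/-- The region on the left of a directed edge. -/
def region (e : ZMod (2 * n) × Bool) : D.Face := Quot.mk _ e

theorem region_surjective : Function.Surjective D.region := Quot.exists_rep

@[simp] theorem region_turnLeft (e : ZMod (2 * n) × Bool) :
    D.region (D.turnLeft e) = D.region e :=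
  (Quot.sound (r := fun e e' => e' = D.turnLeft e) rfl).symm

/-- The cellular coboundary of functions on the regions: the difference of the values on the left
and on the right of each edge. -/
def coboundary : (D.Face → ℚ) →ₗ[ℚ] (ZMod (2 * n) → ℚ) where
  toFun f k := f (D.region (k, true)) - f (D.region (k, false))
  map_add' f g := by ext k; simp; ring
  map_smul' c f := by ext k; simp; ring

/-- The incidence matrix of crossings and edges: edge `k` leads from position `k - 1` to
position `k`, and a loop has entry `0`. -/
def incidence : Matrix (ZMod n) (ZMod (2 * n)) ℚ :=
  Matrix.of fun i k => (if (D.pass k).1 = i then 1 else 0) - if (D.pass (k - 1)).1 = i then 1 else 0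

variable [NeZero n]

theorem incidence_mulVec (c : ZMod (2 * n) → ℚ) (i : ZMod n) :
    (D.incidence *ᵥ c) i =
      c (D.overPos i) + c (D.underPos i) - c (D.overPos i + 1) - c (D.underPos i + 1) := by
  have h1 : ∑ k, (if (D.pass k).1 = i then c k else 0) = c (D.overPos i) + c (D.underPos i) := by
    rw [D.sum_positions, Finset.sum_eq_single i] <;> simp +contextual
  have h2 : ∑ k, (if (D.pass (k - 1)).1 = i then c k else 0) =
      c (D.overPos i + 1) + c (D.underPos i + 1) := by
    rw [← Equiv.sum_comp (Equiv.addRight (1 : ZMod (2 * n))), D.sum_positions,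
      Finset.sum_eq_single i] <;> simp +contextual
  simp only [mulVec, dotProduct, incidence, of_apply, sub_mul, ite_mul, one_mul, zero_mul,
    Finset.sum_sub_distrib, h1, h2]
  ring

theorem incidence_transpose_mulVec (g : ZMod n → ℚ) (k : ZMod (2 * n)) :
    (D.incidenceᵀ *ᵥ g) k = g (D.pass k).1 - g (D.pass (k - 1)).1 := by
  simp [mulVec, dotProduct, incidence, sub_mul, Finset.sum_sub_distrib]

theorem range_coboundary_le_ker_incidence :
    LinearMap.range D.coboundary ≤ LinearMap.ker D.incidence.mulVecLin := by
  rintro _ ⟨f, rfl⟩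
  rw [LinearMap.mem_ker]
  ext i
  have h := D.corners (f := fun e => f (D.region e)) (fun e => by simp) i
  rw [mulVecLin_apply, incidence_mulVec]
  simp only [coboundary, LinearMap.coe_mk, AddHom.coe_mk, Pi.zero_apply]
  split_ifs at h <;> simp only [h] <;> ring

/-- A linear map whose kernel consists of multiples of one vector has rank at least
`finrank K V - 1`. -/
theorem _root_.LinearMap.finrank_le_finrank_range_add_one {K V W : Type*} [Field K]
    [AddCommGroup V] [Module K V] [AddCommGroup W] [Module K W] [FiniteDimensional K V]
    (φ : V →ₗ[K] W) (v : V) (h : ∀ x, φ x = 0 → ∃ c : K, c • v = x) :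
    Module.finrank K V ≤ Module.finrank K (LinearMap.range φ) + 1 := by
  have h1 := φ.finrank_range_add_finrank_ker
  have h2 : LinearMap.ker φ ≤ Submodule.span K {v} := fun x hx =>
    Submodule.mem_span_singleton.2 (h x hx)
  have h3 := (Submodule.finrank_mono h2).trans (finrank_span_le_card ({v} : Set V))
  simp at h3
  omega

instance : Finite D.Face := inferInstanceAs (Finite (Quot _))

/-- A diagram on a surface of Euler characteristic `2`: every function on the edges with zero
divergence at the crossings is the coboundary of a function on the regions.  The inclusion is an
equality since the first space has dimension at least `(n + 2) - 1` (only constants have coboundary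
zero, the regions being connected across edges) and the second at most `2 * n - (n - 1)` (the knot
being connected). -/
theorem range_coboundary_eq (hD : Nat.card D.Face = n + 2) :
    LinearMap.range D.coboundary = LinearMap.ker D.incidence.mulVecLin := by
  have := Fintype.ofFinite D.Face
  apply Submodule.eq_of_le_of_finrank_le D.range_coboundary_le_ker_incidence
  have h1 := D.coboundary.finrank_le_finrank_range_add_one 1 fun f hf =>
    ⟨f (D.region (0, true)), by
      ext q
      obtain ⟨e, rfl⟩ := D.region_surjective q
      have := D.eq_of_turnLeft_of_reverse (f := fun e => f (D.region e))
        (fun e => by simp) (fun k => sub_eq_zero.1 (congrFun hf k)) e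
      simp [this]⟩
  have h2 := D.incidenceᵀ.mulVecLin.finrank_le_finrank_range_add_one 1 fun g hg =>
    ⟨g (D.pass 0).1, by
      have hk := ZMod.eq_zero_apply_of_add_one (g := fun k => g (D.pass k).1) fun k => by
        have := congrFun hg (k + 1)
        rw [mulVecLin_apply, incidence_transpose_mulVec] at this
        simpa [sub_eq_zero] using this
      ext i
      simpa using (hk (D.overPos i)).symm⟩
  have h3 : Module.finrank ℚ (LinearMap.range D.incidenceᵀ.mulVecLin) =
      Module.finrank ℚ (LinearMap.range D.incidence.mulVecLin) := D.incidence.rank_transpose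
  have h4 := D.incidence.mulVecLin.finrank_range_add_finrank_ker
  rw [Module.finrank_fintype_fun_eq_card] at h1 h2 h4
  rw [← Nat.card_eq_fintype_card, hD] at h1
  rw [ZMod.card] at h2 h4
  omega

/-- The Alexander numbering: the regions of a planar diagram can be numbered by integers so that
the number on the left of an edge exceeds that on its right by one.  Here `L k` is the number on
the left of edge `k`; the conditions express that the numbers around a crossing match. -/
theorem exists_alexanderNumbering (hD : Nat.card D.Face = n + 2) :
    ∃ L : ZMod (2 * n) → ℤ, ∀ i, L (D.overPos i + 1) = L (D.underPos i) ∧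
      L (D.underPos i + 1) = L (D.overPos i) ∧
      L (D.underPos i) = L (D.overPos i) + if D.leftToRight i then 1 else -1 := by
  have hone : (1 : ZMod (2 * n) → ℚ) ∈ LinearMap.range D.coboundary := by
    rw [D.range_coboundary_eq hD, LinearMap.mem_ker]
    ext i
    rw [mulVecLin_apply, incidence_mulVec]
    simp
  obtain ⟨f, hf⟩ := hone
  set l : ZMod (2 * n) → ℚ := fun k => f (D.region (k, true))
  have hr : ∀ k, f (D.region (k, false)) = l k - 1 := fun k => by
    have : l k - f (D.region (k, false)) = 1 := congrFun hf k
    linarith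
  have hc : ∀ i, l (D.overPos i + 1) = l (D.underPos i) ∧
      l (D.underPos i + 1) = l (D.overPos i) ∧
      l (D.underPos i) = l (D.overPos i) + if D.leftToRight i then 1 else -1 := fun i => by
    have h := D.corners (f := fun e => f (D.region e)) (fun e => by simp) i
    simp only [hr] at h
    change if D.leftToRight i then l _ = _ ∧ l _ = l _ ∧ _ = l _ ∧ _ else
      l _ = l _ ∧ _ = l _ ∧ _ ∧ l _ = _ at h
    split_ifs at h ⊢ <;> refine ⟨?_, ?_, ?_⟩ <;> linarith
  -- the rational numbering found so far has integral differences
  have hint : ∀ m : ℕ, ∃ z : ℤ, (z : ℚ) = l (m : ZMod (2 * n)) - l 0 := fun m => by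
    induction m with
    | zero => exact ⟨0, by simp⟩
    | succ m ih =>
      obtain ⟨z, hz⟩ := ih
      rw [Nat.cast_succ]
      obtain ⟨i, h | h⟩ := D.exists_eq_pos (m : ZMod (2 * n)) <;> rw [h] at hz ⊢ <;>
        obtain ⟨h1, h2, h3⟩ := hc i
      · exact ⟨z + if D.leftToRight i then 1 else -1, by
          push_cast; rw [h1, h3, hz]; ring⟩
      · exact ⟨z - if D.leftToRight i then 1 else -1, by
          push_cast; rw [h2, hz, h3]; ring⟩
  have hint' : ∀ k, ∃ z : ℤ, (z : ℚ) = l k - l 0 := fun k => by simpa using hint k.val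
  choose L hL using hint'
  refine ⟨L, fun i => ?_⟩
  obtain ⟨h1, h2, h3⟩ := hc i
  refine ⟨?_, ?_, ?_⟩ <;> rw [← Int.cast_inj (α := ℚ)] <;> push_cast <;> simp only [hL] <;> linarith

end KnotCode

/-! ### The Alexander matrix -/

theorem foxAction_of {ι : Type} [DecidableEq ι] (i : ι) (v : ι → ℤ[T;T⁻¹]) :
    foxAction ι (FreeGroup.of i) v = Pi.single i 1 + (LaurentPolynomial.T 1 : ℤ[T;T⁻¹]) • v := by
  simp [foxAction, AffineEquiv.mul_def, LinearEquiv.smulOfUnit, Units.smul_def]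

/-- The Fox derivatives of a relator that states the relation `x_a x_b = x_b x_c`. -/
theorem foxDerivative_relator {ι : Type} [DecidableEq ι] (a b c : ι) :
    foxDerivative (FreeGroup.of a * FreeGroup.of b * (FreeGroup.of c)⁻¹ * (FreeGroup.of b)⁻¹) =
      Pi.single a 1 + (LaurentPolynomial.T 1 - 1 : ℤ[T;T⁻¹]) • Pi.single b 1 -
        (LaurentPolynomial.T 1 : ℤ[T;T⁻¹]) • Pi.single c 1 := by
  set t : ℤ[T;T⁻¹] := LaurentPolynomial.T 1 with ht
  set s : ℤ[T;T⁻¹] := LaurentPolynomial.T (-1) with hs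
  have hts : t * s = 1 := by rw [ht, hs, ← LaurentPolynomial.T_add]; simp
  have hinv : ∀ (i : ι) v, foxAction ι (FreeGroup.of i)⁻¹ v = s • (v - Pi.single i 1) := by
    intro i v
    apply (foxAction ι (FreeGroup.of i)).injective
    rw [foxAction_of i (s • _), smul_smul, ← ht, hts, one_smul, map_inv, add_sub_cancel]
    exact (foxAction ι (FreeGroup.of i)).apply_symm_apply v
  rw [foxDerivative, map_mul, map_mul, map_mul, AffineEquiv.mul_def, AffineEquiv.mul_def,
    AffineEquiv.mul_def, AffineEquiv.trans_apply, AffineEquiv.trans_apply, AffineEquiv.trans_apply,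
    hinv, hinv, foxAction_of, foxAction_of, ← ht]
  ext1 j
  simp only [Pi.add_apply, Pi.smul_apply, Pi.sub_apply, Pi.zero_apply, smul_eq_mul]
  generalize (Pi.single a 1 : ι → ℤ[T;T⁻¹]) j = A
  generalize (Pi.single b 1 : ι → ℤ[T;T⁻¹]) j = B
  generalize (Pi.single c 1 : ι → ℤ[T;T⁻¹]) j = C
  linear_combination (-t * C - B * (1 + t * s)) * hts

namespace KnotDiagram

variable {n : ℕ} (D : KnotDiagram n)

/-- The lower arc at crossing `i` that lies on the left of the upper strand. -/
def leftArc (i : ZMod n) : ZMod n := if D.leftToRight i then i else i + 1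

/-- The lower arc at crossing `i` that lies on the right of the upper strand. -/
def rightArc (i : ZMod n) : ZMod n := if D.leftToRight i then i + 1 else i

theorem relator_eq (i : ZMod n) :
    D.relator i = FreeGroup.of (D.leftArc i) * FreeGroup.of (D.overArc i) *
      (FreeGroup.of (D.rightArc i))⁻¹ * (FreeGroup.of (D.overArc i))⁻¹ := by
  unfold relator leftArc rightArc
  split_ifs <;> rfl

theorem alexanderMatrix_apply (i : ZMod n) :
    D.alexanderMatrix i = Pi.single (D.leftArc i) 1 +
      (LaurentPolynomial.T 1 - 1 : ℤ[T;T⁻¹]) • Pi.single (D.overArc i) 1 -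
        (LaurentPolynomial.T 1 : ℤ[T;T⁻¹]) • Pi.single (D.rightArc i) 1 := by
  rw [← foxDerivative_relator, ← relator_eq]; rfl

variable [NeZero n]

theorem map_alexanderMatrix_mulVec {R : Type*} [CommRing R] (φ : ℤ[T;T⁻¹] →+* R)
    (v : ZMod n → R) (i : ZMod n) :
    (D.alexanderMatrix.map φ *ᵥ v) i = v (D.leftArc i) +
      (φ (LaurentPolynomial.T 1) - 1) * v (D.overArc i) -
        φ (LaurentPolynomial.T 1) * v (D.rightArc i) := by
  have hs : ∀ a b : ZMod n, φ ((Pi.single a 1 : ZMod n → ℤ[T;T⁻¹]) b) =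
      (Pi.single a 1 : ZMod n → R) b := fun a b => by
    simp [Pi.single_apply, apply_ite φ]
  have : (D.alexanderMatrix.map φ) i = Pi.single (D.leftArc i) 1 +
      (φ (LaurentPolynomial.T 1) - 1) • Pi.single (D.overArc i) 1 -
        φ (LaurentPolynomial.T 1) • Pi.single (D.rightArc i) 1 := by
    ext j
    rw [map_apply, alexanderMatrix_apply]
    simp only [Pi.sub_apply, Pi.add_apply, Pi.smul_apply, smul_eq_mul, map_sub, map_add, map_mul,
      map_one, hs]
  change (D.alexanderMatrix.map φ) i ⬝ᵥ v = _
  rw [this]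
  simp [sub_dotProduct, add_dotProduct]

theorem map_alexanderMatrix_mulVec_one {R : Type*} [CommRing R] (φ : ℤ[T;T⁻¹] →+* R) :
    D.alexanderMatrix.map φ *ᵥ 1 = 0 := by
  ext i
  rw [map_alexanderMatrix_mulVec]
  simp

/-- The rows of the Alexander matrix satisfy a linear relation with unit coefficients (one
Wirtinger relation follows from the others).  With `t ^ (-L k)` as weight of edge `k`, where `L` is
the Alexander numbering, the row of each crossing, times a suitable `± t ^ r`, is the weighted sum
of the incoming minus that of the outgoing edges, and the sum of these over the knot vanishes. -/
theorem exists_unit_vecMul_alexanderMatrix_eq_zero :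
    ∃ u : ZMod n → ℤ[T;T⁻¹], (∀ i, IsUnit (u i)) ∧ u ᵥ* D.alexanderMatrix = 0 := by
  obtain ⟨L, hL⟩ := D.exists_alexanderNumbering D.planar
  let w : ZMod (2 * n) → ZMod n → ℤ[T;T⁻¹] := fun k =>
    (LaurentPolynomial.T (-L k) : ℤ[T;T⁻¹]) • Pi.single (D.arc k) 1
  refine ⟨fun i => if D.leftToRight i then LaurentPolynomial.T (-L (D.underPos i))
    else -LaurentPolynomial.T (-L (D.overPos i)), fun i => ?_, ?_⟩
  · dsimp only
    split_ifs
    · exact LaurentPolynomial.isUnit_T _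
    · exact (LaurentPolynomial.isUnit_T _).neg
  have hsum : ∑ k, (w k - w (k + 1)) = 0 := by
    rw [Finset.sum_sub_distrib, sub_eq_zero]
    exact (Equiv.sum_comp (Equiv.addRight (1 : ZMod (2 * n))) w).symm
  rw [vecMul_eq_sum, ← hsum, D.sum_positions]
  refine Finset.sum_congr rfl fun i _ => ?_
  obtain ⟨h1, h2, h3⟩ := hL i
  have a1 : D.arc (D.overPos i + 1) = D.arc (D.overPos i) := D.arc_over i
  have a2 : D.arc (D.underPos i) = i := D.arc_under i
  have a3 : D.arc (D.underPos i + 1) = i + 1 := D.arc_under_succ i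
  have a4 : D.overArc i = D.arc (D.overPos i) := rfl
  simp only [w, a1, a2, a3, h1, h2, alexanderMatrix_apply, leftArc, rightArc, a4]
  split_ifs at h3 ⊢
  · have ht : (LaurentPolynomial.T (-L (D.overPos i)) : ℤ[T;T⁻¹]) =
        LaurentPolynomial.T (-L (D.underPos i)) * LaurentPolynomial.T 1 := by
      rw [← LaurentPolynomial.T_add]; congr 1; omega
    rw [ht]
    module
  · have ht : (LaurentPolynomial.T (-L (D.underPos i)) : ℤ[T;T⁻¹]) =
        LaurentPolynomial.T (-L (D.overPos i)) * LaurentPolynomial.T 1 := by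
      rw [← LaurentPolynomial.T_add]; congr 1; omega
    rw [ht]
    module

variable {D} in
/-- The minors of the Alexander matrix are associated to each other, hence to the Alexander
polynomial. -/
theorem IsAlexanderPolynomial.associated_adjugate {Δ : ℤ[T;T⁻¹]} (hΔ : D.IsAlexanderPolynomial Δ)
    (i j : ZMod n) : Associated Δ (D.alexanderMatrix.adjugate i j) := by
  obtain ⟨u, hu, huA⟩ := D.exists_unit_vecMul_alexanderMatrix_eq_zero
  have h1 : D.alexanderMatrix *ᵥ 1 = 0 := by
    simpa using D.map_alexanderMatrix_mulVec_one (RingHom.id _)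
  exact associated_of_dvd_dvd (hΔ.1 i j)
    (hΔ.2 _ fun i' j' => adjugate_dvd_adjugate h1 hu huA i j i' j')

variable {D} in
/-- Fox colorings: `Δ` vanishes at a point of a field exactly if the Alexander matrix has a
non-constant kernel vector there. -/
theorem IsAlexanderPolynomial.map_eq_zero_iff {Δ : ℤ[T;T⁻¹]} (hΔ : D.IsAlexanderPolynomial Δ)
    {k : Type*} [Field k] (φ : ℤ[T;T⁻¹] →+* k) :
    φ Δ = 0 ↔ ∃ v, D.alexanderMatrix.map φ *ᵥ v = 0 ∧ ∃ a b, v a ≠ v b := by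
  obtain ⟨u, hu, huA⟩ := D.exists_unit_vecMul_alexanderMatrix_eq_zero
  have huA' : (φ ∘ u) ᵥ* D.alexanderMatrix.map φ = 0 := by
    ext j
    rw [← RingHom.map_vecMul, huA]
    simp
  rw [exists_mulVec_eq_zero_not_const_iff (D.map_alexanderMatrix_mulVec_one φ)
      (fun i => ((hu i).map φ).ne_zero) huA' 0 0]
  have hadj := congrFun (congrFun (φ.map_adjugate D.alexanderMatrix) 0) 0
  rw [RingHom.mapMatrix_apply, RingHom.mapMatrix_apply, map_apply] at hadj
  rw [← hadj]
  exact ((hΔ.associated_adjugate 0 0).map φ).eq_zero_iff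

/-- At `t = 1` a kernel vector of the Alexander matrix is constant. -/
theorem eq_of_map_alexanderMatrix_mulVec_eq_zero {R : Type*} [CommRing R] {φ : ℤ[T;T⁻¹] →+* R}
    (hφ : φ (LaurentPolynomial.T 1) = 1) {v : ZMod n → R}
    (hv : D.alexanderMatrix.map φ *ᵥ v = 0) (a b : ZMod n) : v a = v b := by
  have h : ∀ i, v (i + 1) = v i := fun i => by
    have := congrFun hv i
    rw [map_alexanderMatrix_mulVec, hφ] at this
    unfold leftArc rightArc at this
    split_ifs at this <;> simp [sub_eq_zero] at this <;> simp [this]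
  rw [ZMod.eq_zero_apply_of_add_one h a, ZMod.eq_zero_apply_of_add_one h b]

end KnotDiagram

/-! ### Groups of affine maps of a field -/

section Affine

variable {k : Type*} [Field k]

/-- The affine map `z ↦ a z + b` of a field. -/
def affineMapOf (a : kˣ) (b : k) : k ≃ᵃ[k] k :=
  AffineEquiv.constVAdd k k b * (LinearEquiv.smulOfUnit a).toAffineEquiv

@[simp] theorem affineMapOf_apply (a : kˣ) (b z : k) : affineMapOf a b z = a * z + b := by
  simp [affineMapOf, AffineEquiv.mul_def, LinearEquiv.smulOfUnit, Units.smul_def, add_comm]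

theorem affineMapOf_mul (a a' : kˣ) (b b' : k) :
    affineMapOf a b * affineMapOf a' b' = affineMapOf (a * a') (a * b' + b) := by
  ext z
  rw [AffineEquiv.mul_def, AffineEquiv.trans_apply]
  simp only [affineMapOf_apply, Units.val_mul]
  ring

theorem affineMapOf_inj {a a' : kˣ} {b b' : k} :
    affineMapOf a b = affineMapOf a' b' ↔ a = a' ∧ b = b' := by
  refine ⟨fun h => ?_, fun h => by rw [h.1, h.2]⟩
  have h0 := DFunLike.congr_fun h 0
  have h1 := DFunLike.congr_fun h 1
  simp only [affineMapOf_apply, mul_zero, zero_add, mul_one] at h0 h1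
  rw [h0, add_left_inj] at h1
  exact ⟨Units.ext h1, h0⟩

@[simp] theorem affineMapOf_one_zero : affineMapOf (1 : kˣ) 0 = 1 := by
  ext z; simp

theorem affineMapOf_inv (a : kˣ) (b : k) :
    (affineMapOf a b)⁻¹ = affineMapOf a⁻¹ (-(((a⁻¹ : kˣ) : k) * b)) := by
  rw [inv_eq_iff_mul_eq_one, affineMapOf_mul, ← affineMapOf_one_zero, affineMapOf_inj]
  simp

theorem eq_affineMapOf_iff {g : k ≃ᵃ[k] k} {a : kˣ} {b : k} :
    g = affineMapOf a b ↔ ∀ z, g z = a * z + b := by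
  simp [AffineEquiv.ext_iff]

theorem mem_affineSemidirect_iff {α : kˣ} {g : k ≃ᵃ[k] k} :
    g ∈ affineSemidirect α ↔ ∃ (m : ℤ) (b : k), g = affineMapOf (α ^ m) b := by
  simp only [eq_affineMapOf_iff]; rfl

theorem natCard_affineSemidirect (α : kˣ) :
    Nat.card (affineSemidirect α) = orderOf α * Nat.card k := by
  rw [← Nat.card_zpowers, ← Nat.card_prod]
  refine (Nat.card_eq_of_bijective
    (fun q : Subgroup.zpowers α × k => (⟨affineMapOf q.1 q.2, ?_⟩ : affineSemidirect α))
    ⟨?_, ?_⟩).symm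
  · obtain ⟨⟨_, m, rfl⟩, b⟩ := q
    exact mem_affineSemidirect_iff.2 ⟨m, b, rfl⟩
  · rintro ⟨a, b⟩ ⟨a', b'⟩ h
    obtain ⟨h1, h2⟩ := affineMapOf_inj.1 (congrArg Subtype.val h)
    exact Prod.ext (Subtype.ext h1) h2
  · rintro ⟨g, hg⟩
    obtain ⟨m, b, rfl⟩ := mem_affineSemidirect_iff.1 hg
    exact ⟨(⟨α ^ m, m, rfl⟩, b), rfl⟩

theorem commutator_affineMapOf (a a' : kˣ) (b b' : k) :
    ∃ c, affineMapOf a b * affineMapOf a' b' * (affineMapOf a b)⁻¹ * (affineMapOf a' b')⁻¹ =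
      affineMapOf 1 c := by
  rw [affineMapOf_inv, affineMapOf_inv, affineMapOf_mul, affineMapOf_mul,
    affineMapOf_mul]
  exact ⟨_, affineMapOf_inj.2 ⟨by rw [mul_comm a a']; simp, rfl⟩⟩

/-- The commutators in `⟨α⟩ ⋉ k` are translations, and translations commute. -/
theorem isMetabelian_affineSemidirect (α : kˣ) : IsMetabelian (affineSemidirect α) := by
  let N : Subgroup (affineSemidirect α) := (affineSemidirect (1 : kˣ)).subgroupOf _
  have hN : ∀ g : affineSemidirect α, g ∈ N ↔ ∃ b, (g : k ≃ᵃ[k] k) = affineMapOf 1 b := fun g => by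
    rw [Subgroup.mem_subgroupOf, mem_affineSemidirect_iff]
    simp
  have h1 : derivedSeries (affineSemidirect α) 1 ≤ N := by
    rw [derivedSeries_one, commutator_def, Subgroup.commutator_le]
    rintro ⟨g, hg⟩ - ⟨h, hh⟩ -
    obtain ⟨m, b, rfl⟩ := mem_affineSemidirect_iff.1 hg
    obtain ⟨m', b', rfl⟩ := mem_affineSemidirect_iff.1 hh
    exact (hN _).2 (commutator_affineMapOf _ _ _ _)
  rw [IsMetabelian, derivedSeries_succ, eq_bot_iff, Subgroup.commutator_le]
  intro g hg h hh
  obtain ⟨b, hb⟩ := (hN g).1 (h1 hg)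
  obtain ⟨c, hc⟩ := (hN h).1 (h1 hh)
  rw [Subgroup.mem_bot, commutatorElement_eq_one_iff_mul_comm]
  apply Subtype.ext
  rw [Subgroup.coe_mul, Subgroup.coe_mul, hb, hc, affineMapOf_mul, affineMapOf_mul,
    affineMapOf_inj]
  simp [add_comm]

theorem affineMapOf_mul_comm_iff {α : kˣ} {b c : k} :
    affineMapOf α b * affineMapOf α c = affineMapOf α c * affineMapOf α b ↔
      (α : k) = 1 ∨ b = c := by
  rw [affineMapOf_mul, affineMapOf_mul, affineMapOf_inj, ← sub_eq_zero (b := (1 : k)),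
    ← sub_eq_zero (a := b), ← mul_eq_zero]
  constructor
  · rintro ⟨-, h⟩
    linear_combination -h
  · exact fun h => ⟨rfl, by linear_combination -h⟩

/-- If `α` generates `k` over the prime field, a subgroup of `⟨α⟩ ⋉ k` that contains a map of slope
`α` and is not abelian is the whole group: its translations form a non-zero subspace of `k` over
`𝔽_p(α) = k`. -/
theorem eq_affineSemidirect_of_not_comm {p : ℕ} [Fact p.Prime] [Algebra (ZMod p) k]
    [FiniteDimensional (ZMod p) k] {α : kˣ}
    (hα : IntermediateField.adjoin (ZMod p) {(α : k)} = ⊤) {H : Subgroup (k ≃ᵃ[k] k)}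
    (hle : H ≤ affineSemidirect α) {y : k} (hy : affineMapOf α y ∈ H) (hH : IsNonabelian H) :
    H = affineSemidirect α := by
  -- a non-trivial commutator is a non-zero translation in `H`
  obtain ⟨b, hb0, hb⟩ : ∃ b : k, b ≠ 0 ∧ affineMapOf 1 b ∈ H := by
    obtain ⟨⟨g, hg⟩, ⟨h, hh⟩, hne⟩ := hH
    obtain ⟨m, b, rfl⟩ := mem_affineSemidirect_iff.1 (hle hg)
    obtain ⟨m', b', rfl⟩ := mem_affineSemidirect_iff.1 (hle hh)
    obtain ⟨c, hc⟩ := commutator_affineMapOf (α ^ m) (α ^ m') b b'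
    refine ⟨c, ?_, ?_⟩
    · rintro rfl
      rw [affineMapOf_one_zero, mul_inv_eq_one, mul_inv_eq_iff_eq_mul] at hc
      exact hne (Subtype.ext hc)
    · rw [← hc]
      exact mul_mem (mul_mem (mul_mem hg hh) (inv_mem hg)) (inv_mem hh)
  have hadd : ∀ c d, affineMapOf 1 c ∈ H → affineMapOf 1 d ∈ H → affineMapOf 1 (c + d) ∈ H :=
    fun c d hc hd => by
      have := mul_mem hd hc
      rw [affineMapOf_mul] at this
      simpa using this
  have hsmul : ∀ (r : ZMod p) c, affineMapOf 1 c ∈ H →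
      affineMapOf 1 (algebraMap (ZMod p) k r * c) ∈ H := fun r c hc => by
    rw [← ZMod.natCast_zmod_val r, map_natCast]
    induction r.val with
    | zero => simp
    | succ m ih =>
      rw [Nat.cast_succ, add_mul, one_mul]
      exact hadd _ _ ih hc
  have hmul : ∀ c, affineMapOf 1 c ∈ H → affineMapOf 1 (α * c) ∈ H := fun c hc => by
    have := mul_mem (mul_mem hy hc) (inv_mem hy)
    rw [affineMapOf_inv, affineMapOf_mul, affineMapOf_mul] at this
    convert this using 1
    rw [affineMapOf_inj]
    constructor
    · simp
    · simp
  have hall : ∀ x c : k, affineMapOf 1 c ∈ H → affineMapOf 1 (x * c) ∈ H := fun x => by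
    have hx : x ∈ Algebra.adjoin (ZMod p) {(α : k)} := by
      rw [← IntermediateField.adjoin_simple_toSubalgebra_of_isAlgebraic
        (Algebra.IsAlgebraic.isAlgebraic _), hα]
      trivial
    induction hx using Algebra.adjoin_induction with
    | mem x hx =>
      obtain rfl : x = α := hx
      exact hmul
    | algebraMap r => exact hsmul r
    | add x x' _ _ h h' =>
      intro c hc
      rw [add_mul]
      exact hadd _ _ (h c hc) (h' c hc)
    | mul x x' _ _ h h' =>
      intro c hc
      rw [mul_assoc]
      exact h _ (h' c hc)
  have htrans : ∀ c : k, affineMapOf 1 c ∈ H := fun c => by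
    simpa [hb0] using hall (c / b) b hb
  refine le_antisymm hle fun g hg => ?_
  obtain ⟨m, c, rfl⟩ := mem_affineSemidirect_iff.1 hg
  have hα' : affineMapOf α 0 ∈ H := by
    simpa [affineMapOf_mul] using mul_mem (htrans (-y)) hy
  have hpow : affineMapOf (α ^ m) 0 = affineMapOf α 0 ^ m := by
    let f : kˣ →* (k ≃ᵃ[k] k) :=
      { toFun := fun a => affineMapOf a 0
        map_one' := affineMapOf_one_zero
        map_mul' := fun a a' => by simp [affineMapOf_mul] }
    exact map_zpow f α m
  have := mul_mem (htrans c) (zpow_mem hα' m)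
  rw [← hpow, affineMapOf_mul] at this
  simpa using this

end Affine

/-! ### Affine representations of the knot group -/

namespace KnotDiagram

variable {n : ℕ} (D : KnotDiagram n) {k : Type*} [Field k] {α : kˣ}

theorem range_le_of_meridian_mem {G : Type*} [Group G] {ρ : D.knotGroup →* G} {H : Subgroup G}
    (h : ∀ i, ρ (D.meridian i) ∈ H) : ρ.range ≤ H := by
  rw [MonoidHom.range_eq_map, ← PresentedGroup.closure_range_of, MonoidHom.map_closure,
    Subgroup.closure_le]
  rintro _ ⟨_, ⟨i, rfl⟩, rfl⟩
  exact h i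

theorem hasSlope_iff {ρ : D.knotGroup →* (k ≃ᵃ[k] k)} :
    D.HasSlope ρ α ↔ ∃ y : ZMod n → k, ∀ i, ρ (D.meridian i) = affineMapOf α (y i) := by
  simp only [HasSlope, eq_affineMapOf_iff]
  exact Classical.skolem

theorem range_le_of_hasSlope {ρ : D.knotGroup →* (k ≃ᵃ[k] k)} (hρ : D.HasSlope ρ α) :
    ρ.range ≤ affineSemidirect α := by
  obtain ⟨y, hy⟩ := D.hasSlope_iff.1 hρ
  exact D.range_le_of_meridian_mem fun i =>
    mem_affineSemidirect_iff.2 ⟨1, y i, by rw [hy, zpow_one]⟩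

variable [NeZero n]

/-- The assignment `x_i ↦ (z ↦ α z + y_i)` respects a Wirtinger relation exactly if the
corresponding row of the Alexander matrix at `t = α` annihilates `y`. -/
theorem lift_relator_eq_one_iff {φ : ℤ[T;T⁻¹] →+* k} (hφ : φ (LaurentPolynomial.T 1) = α)
    (y : ZMod n → k) (i : ZMod n) :
    FreeGroup.lift (fun a => affineMapOf α (y a)) (D.relator i) = 1 ↔
      (D.alexanderMatrix.map φ *ᵥ y) i = 0 := by
  rw [map_alexanderMatrix_mulVec, hφ, relator_eq]
  simp only [map_mul, map_inv, FreeGroup.lift_apply_of]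
  rw [mul_inv_eq_one, mul_inv_eq_iff_eq_mul, affineMapOf_mul, affineMapOf_mul, affineMapOf_inj,
    ← sub_eq_zero (a := (_ : k))]
  constructor
  · rintro ⟨-, h⟩
    linear_combination h
  · exact fun h => ⟨rfl, by linear_combination h⟩

/-- Representations in which the meridians have slope `α` correspond to kernel vectors of the
Alexander matrix at `t = α`; the non-abelian ones to the non-constant kernel vectors. -/
theorem exists_hasSlope_isNonabelian_iff {φ : ℤ[T;T⁻¹] →+* k}
    (hφ : φ (LaurentPolynomial.T 1) = α) :
    (∃ ρ : D.knotGroup →* (k ≃ᵃ[k] k), D.HasSlope ρ α ∧ IsNonabelian ρ.range) ↔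
      ∃ y, D.alexanderMatrix.map φ *ᵥ y = 0 ∧ ∃ a b, y a ≠ y b := by
  constructor
  · rintro ⟨ρ, hρ, hna⟩
    obtain ⟨y, hy⟩ := D.hasSlope_iff.1 hρ
    have hlift : FreeGroup.lift (fun a => affineMapOf α (y a)) =
        ρ.comp (PresentedGroup.mk (Set.range D.relator)) := by
      ext1 a
      rw [FreeGroup.lift_apply_of, ← hy]
      rfl
    refine ⟨y, funext fun i => ?_, ?_⟩
    · rw [Pi.zero_apply, ← D.lift_relator_eq_one_iff hφ, hlift, MonoidHom.comp_apply,
        PresentedGroup.one_of_mem (Set.mem_range_self i), map_one]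
    · by_contra! hconst
      obtain ⟨⟨g, hg⟩, ⟨h, hh⟩, hne⟩ := hna
      have hle : ρ.range ≤ Subgroup.zpowers (affineMapOf α (y 0)) :=
        D.range_le_of_meridian_mem fun i => by
          rw [hy, hconst i 0]
          exact Subgroup.mem_zpowers _
      obtain ⟨l, rfl⟩ := hle hg
      obtain ⟨m, rfl⟩ := hle hh
      exact hne (Subtype.ext (zpow_mul_comm _ l m))
  · rintro ⟨y, hy, a, b, hab⟩
    let ρ : D.knotGroup →* (k ≃ᵃ[k] k) :=
      PresentedGroup.toGroup (f := fun a => affineMapOf α (y a)) (by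
        rintro _ ⟨i, rfl⟩
        exact (D.lift_relator_eq_one_iff hφ y i).2 (congrFun hy i))
    have hρ : ∀ i, ρ (D.meridian i) = affineMapOf α (y i) := fun i => PresentedGroup.toGroup.of _
    refine ⟨ρ, D.hasSlope_iff.2 ⟨y, hρ⟩, ⟨_, D.meridian a, rfl⟩, ⟨_, D.meridian b, rfl⟩,
      fun h => ?_⟩
    have h' := congrArg Subtype.val h
    simp only [Subgroup.coe_mul, hρ] at h'
    rcases affineMapOf_mul_comm_iff.1 h' with h1 | h1
    · exact hab (D.eq_of_map_alexanderMatrix_mulVec_eq_zero (hφ.trans h1) hy a b)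
    · exact hab h1

end KnotDiagram

theorem theorem2 {n : ℕ} [NeZero n] (D : KnotDiagram n)
    (Δ : LaurentPolynomial ℤ) (hΔ : D.IsAlexanderPolynomial Δ)
    (p : ℕ) [Fact p.Prime]
    {k : Type*} [Field k] [Algebra (ZMod p) k] [FiniteDimensional (ZMod p) k]
    (α : kˣ) (hα : IntermediateField.adjoin (ZMod p) {(α : k)} = ⊤) :
    ((∃ ρ : D.knotGroup →* (k ≃ᵃ[k] k),
        D.HasSlope ρ α ∧ ρ.range = affineSemidirect α ∧ IsNonabelian ρ.range) ↔
      IsRootMod p Δ α) ∧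
    ∀ ρ : D.knotGroup →* (k ≃ᵃ[k] k), D.HasSlope ρ α → IsNonabelian ρ.range →
      ρ.range = affineSemidirect α ∧ IsMetabelian ρ.range ∧
        Nat.card ρ.range = orderOf α * p ^ Module.finrank (ZMod p) k := by
  have hrange : ∀ ρ : D.knotGroup →* (k ≃ᵃ[k] k), D.HasSlope ρ α → IsNonabelian ρ.range →
      ρ.range = affineSemidirect α := fun ρ hρ hna => by
    obtain ⟨y, hy⟩ := D.hasSlope_iff.1 hρ
    exact eq_affineSemidirect_of_not_comm hα (D.range_le_of_hasSlope hρ) (y := y 0)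
      ⟨D.meridian 0, hy 0⟩ hna
  constructor
  · rw [IsRootMod, hΔ.map_eq_zero_iff,
      ← D.exists_hasSlope_isNonabelian_iff (α := α) (by simp)]
    exact exists_congr fun ρ =>
      ⟨fun h => ⟨h.1, h.2.2⟩, fun h => ⟨h.1, hrange ρ h.1 h.2, h.2⟩⟩
  · intro ρ hρ hna
    have h := hrange ρ hρ hna
    refine ⟨h, ?_, ?_⟩
    · rw [h]
      exact isMetabelian_affineSemidirect α
    · rw [h, natCard_affineSemidirect, Module.natCard_eq_pow_finrank (K := ZMod p) (V := k),
        Nat.card_zmod]
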